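/- Let $d\ge 1$, $\gamma>0$, and let $\{\xi(z):z\in\mathbb{Z}^d\}$ be independent identically distributed random variables with the Weibull distribution $\mathbb{P}(\xi(z)<x)=1-e^{-x^{\gamma}}$ for $x\ge 0$. Denote by $|\cdot|$ the $\ell^1$-norm and, for $t>e$, put $$\Psi_t(z)=\xi(z)-\frac{|z|}{\gamma t}\log\log t,\quad z\in\mathbb{Z}^d,\qquad r_t=\frac{t(\log t)^{1/\gamma-1}}{\log\log t}.$$ Almost surely, $\Psi_t$ attains its maximum over $\mathbb{Z}^d$ for all $t>e$. Let $Z_t^{(1)}$ be any random variable with values in $\mathbb{Z}^d$ such that, for all sufficiently large $t$, almost surely $\Psi_t(Z_t^{(1)})=\max_{z\in\mathbb{Z}^d}\Psi_t(z)$. Then, as $t\to\infty$, $$\frac{Z_t^{(1)}}{r_t}\Longrightarrow X^{(1)}$$ weakly, where $X^{(1)}$ is an $\mathbb{R}^d$-valued random variable with independent coordinates, each exponentially distributed with parameter $d^{1-1/\gamma}$ and multiplied by an independent uniform random sign; that is, $X^{(1)}$ has density $$p^{(1)}(x)=\frac{d^{d(1-1/\gamma)}}{2^d}\exp\{-d^{1-1/\gamma}|x|\},\qquad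 x\in\mathbb{R}^d.$$ -/

import Mathlib

open MeasureTheory ProbabilityTheory Filter

noncomputable section

namespace WeibullPAM

/-- The `ℓ¹`-norm of a lattice point `z ∈ ℤ^d`, as a real number. -/
def latticeNorm {d : ℕ} (z : Fin d → ℤ) : ℝ := ∑ i, |(z i : ℝ)|

/-- `ξ` is a family of independent identically distributed random variables indexed by `ℤ^d`
whose common law is the Weibull distribution with parameter `γ`,
i.e. `P(ξ(z) < x) = 1 - exp(-x^γ)` for all `x ≥ 0`. -/
structure IsWeibullPotential {Ω : Type*} [MeasurableSpace Ω] {d : ℕ}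
    (γ : ℝ) (ξ : (Fin d → ℤ) → Ω → ℝ) (P : Measure Ω) : Prop where
  measurable : ∀ z, Measurable (ξ z)
  indep : iIndepFun ξ P
  distrib : ∀ z, ∀ x : ℝ, 0 ≤ x →
    P {ω | ξ z ω < x} = ENNReal.ofReal (1 - Real.exp (-x ^ γ))

/-- The functional `Ψ_t(z) = v(z) - |z| / (γ t) · log log t` of a (deterministic) potential `v`. -/
def Psi {d : ℕ} (γ : ℝ) (v : (Fin d → ℤ) → ℝ) (t : ℝ) (z : Fin d → ℤ) : ℝ :=
  v z - latticeNorm z / (γ * t) * Real.log (Real.log t)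

/-- `z` is a point of `ℤ^d` at which `Ψ_t` attains its maximum over `ℤ^d`. -/
def IsMaximiser {d : ℕ} (γ : ℝ) (v : (Fin d → ℤ) → ℝ) (t : ℝ) (z : Fin d → ℤ) : Prop :=
  ∀ y, Psi γ v t y ≤ Psi γ v t z

/-- The scale `r_t = t (log t)^{1/γ - 1} / log log t`. -/
def scale (γ t : ℝ) : ℝ := t * Real.log t ^ (1 / γ - 1) / Real.log (Real.log t)

/-- The uniform distribution on the two signs `1` and `-1`. -/
def signLaw : Measure ℝ :=
  ENNReal.ofReal (1 / 2) • Measure.dirac 1 + ENNReal.ofReal (1 / 2) • Measure.dirac (-1)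

/-- The law of `S * E`, where `S` is a uniform random sign and `E` is an independent exponential
random variable with parameter `r`. -/
def signedExpLaw (r : ℝ) : Measure ℝ :=
  (signLaw.prod (expMeasure r)).map fun p => p.1 * p.2

/-- The law on `ℝ^d` with independent coordinates, each of which is exponentially distributed with
parameter `d^{1 - 1/γ}` and carries a uniform random sign. -/
def limitLaw (d : ℕ) (γ : ℝ) : Measure (Fin d → ℝ) :=
  Measure.pi fun _ => signedExpLaw ((d : ℝ) ^ (1 - 1 / γ))

/-- The density `2^{-d} d^{d(1 - 1/γ)} exp(-d^{1 - 1/γ} |x|)`, with `|x|` the `ℓ¹`-norm. -/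
def limitDensity (d : ℕ) (γ : ℝ) (x : Fin d → ℝ) : ℝ :=
  (d : ℝ) ^ ((d : ℝ) * (1 - 1 / γ)) / 2 ^ d *
    Real.exp (-((d : ℝ) ^ (1 - 1 / γ) * ∑ i, |x i|))

instance : IsProbabilityMeasure signLaw := by
  constructor
  simp only [signLaw, Measure.add_apply, Measure.smul_apply, measure_univ, smul_eq_mul, mul_one]
  rw [← ENNReal.ofReal_add (by norm_num) (by norm_num)]
  norm_num

lemma isProbabilityMeasure_signedExpLaw {r : ℝ} (hr : 0 < r) :
    IsProbabilityMeasure (signedExpLaw r) := by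
  have := isProbabilityMeasure_expMeasure hr
  exact Measure.isProbabilityMeasure_map (by fun_prop)

instance (d : ℕ) [NeZero d] (γ : ℝ) : IsProbabilityMeasure (limitLaw d γ) := by
  have hd : (0 : ℝ) < d := by exact_mod_cast Nat.pos_of_ne_zero (NeZero.ne d)
  have := isProbabilityMeasure_signedExpLaw (Real.rpow_pos_of_pos hd (1 - 1 / γ))
  unfold limitLaw
  infer_instance

end WeibullPAM

end

/-! Let `A_τ` be `level d γ t τ`, write `p` for the limit density and `μ` for the law with that
density. The height `A_τ^(1/γ)` is exceeded at one site with probability `exp(-A_τ) = τ * normConst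
/ r_t^d`. At a site `z` with `|z| = r_t * v` the tilt raises the threshold by `(log t)^(1/γ-1) / γ *
v`. Since `A_τ ~ d log t`, linearising the `γ`-th power multiplies the tail by asymptotically
`exp(-d^(1-1/γ) * v)`. So the expected number of exceedances with `z / r_t ∈ B` is a Riemann sum
tending to `τ * μ(B)` (`tendsto_tsum_tail`).

By independence, exceedances become Poisson: no exceedance of the `τ₁`-level over `B` and of the
`τ₂`-level over `Bᶜ` has limiting probability `exp(-(τ₁ μ(B) + τ₂ μ(Bᶜ)))`
(`IsWeibullPotential.tendsto_measureReal_forall_lt_threshold`). Measured in `τ`, which decreases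
with height, the two maxima behave like independent exponential clocks with rates `μ(B)` and
`μ(Bᶜ)`. The maximiser lies in `B` when the first clock rings first, which has probability `μ(B)`.
The code proves the lower bound by discretising `τ` (`sum_noExceedance_le`, `exists_lt_sum_exp`) and
the upper bound by passing to `Bᶜ`. Sets with Lebesgue-null frontier suffice for weak convergence.
-/

noncomputable section

namespace WeibullPAM

open Topology
open scoped ENNReal

/-! ### Growth of the scale, the level and the tilting rate. -/

/-- The normalising constant of the limit density. -/
def normConst (d : ℕ) (γ : ℝ) : ℝ := (d : ℝ) ^ ((d : ℝ) * (1 - 1 / γ)) / 2 ^ d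

/-- The `γ`-th power of the height above which, on the spatial scale `r_t`, one expects on average
`τ` points of the tilted potential. -/
def level (d : ℕ) (γ t τ : ℝ) : ℝ := Real.log (scale γ t ^ d / (τ * normConst d γ))

lemma normConst_pos (d : ℕ) [NeZero d] (γ : ℝ) : 0 < normConst d γ := by
  have hd : (0 : ℝ) < d := by exact_mod_cast Nat.pos_of_ne_zero (NeZero.ne d)
  unfold normConst
  positivity

lemma limitDensity_eq (d : ℕ) (γ : ℝ) (x : Fin d → ℝ) :
    limitDensity d γ x =
      normConst d γ * Real.exp (-((d : ℝ) ^ (1 - 1 / γ) * ∑ i, |x i|)) := rfl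

lemma scale_pos {γ t : ℝ} (ht : Real.exp 1 < t) : 0 < scale γ t := by
  have h0 : 0 < t := (Real.exp_pos 1).trans ht
  have h1 : 1 < Real.log t := (Real.lt_log_iff_exp_lt h0).2 ht
  have h2 : 0 < Real.log (Real.log t) := Real.log_pos h1
  have h3 : 0 < Real.log t := by linarith
  unfold scale
  positivity

lemma tendsto_log_log_div_log :
    Tendsto (fun t => Real.log (Real.log t) / Real.log t) atTop (𝓝 0) :=
  Real.isLittleO_log_id_atTop.tendsto_div_nhds_zero.comp Real.tendsto_log_atTop

lemma log_scale {γ t : ℝ} (ht : Real.exp 1 < t) :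
    Real.log (scale γ t) =
      Real.log t + (1 / γ - 1) * Real.log (Real.log t) - Real.log (Real.log (Real.log t)) := by
  have h0 : 0 < t := (Real.exp_pos 1).trans ht
  have h1 : 1 < Real.log t := (Real.lt_log_iff_exp_lt h0).2 ht
  have h2 : 0 < Real.log (Real.log t) := Real.log_pos h1
  have h3 : 0 < Real.log t := by linarith
  unfold scale
  rw [Real.log_div (by positivity) h2.ne', Real.log_mul h0.ne' (by positivity), Real.log_rpow h3]

lemma tendsto_log_scale_div_log (γ : ℝ) :
    Tendsto (fun t => Real.log (scale γ t) / Real.log t) atTop (𝓝 1) := by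
  have h1 := tendsto_log_log_div_log
  have h2 : Tendsto (fun t => Real.log (Real.log (Real.log t)) / Real.log (Real.log t) *
      (Real.log (Real.log t) / Real.log t)) atTop (𝓝 (0 * 0)) :=
    (tendsto_log_log_div_log.comp Real.tendsto_log_atTop).mul h1
  have h3 : Tendsto (fun t => 1 + (1 / γ - 1) * (Real.log (Real.log t) / Real.log t) -
      Real.log (Real.log (Real.log t)) / Real.log (Real.log t) *
      (Real.log (Real.log t) / Real.log t)) atTop (𝓝 (1 + (1 / γ - 1) * 0 - 0 * 0)) :=
    (tendsto_const_nhds.add (h1.const_mul _)).sub h2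
  simp only [mul_zero, add_zero, sub_zero] at h3
  refine h3.congr' ?_
  filter_upwards [eventually_gt_atTop (Real.exp 1)] with t ht
  have h0 : 0 < t := (Real.exp_pos 1).trans ht
  have h1 : 1 < Real.log t := (Real.lt_log_iff_exp_lt h0).2 ht
  have h2 : 0 < Real.log (Real.log t) := Real.log_pos h1
  have h3 : 0 < Real.log t := by linarith
  rw [log_scale ht]
  field_simp

/-- Since `log r_t ~ log t`, the parameter `τ` only shifts the level by a constant. The factor `d`
found here is the source of the rate `d^(1-1/γ)`. -/
lemma tendsto_level_div_log (d : ℕ) [NeZero d] (γ : ℝ) {τ : ℝ} (hτ : 0 < τ) :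
    Tendsto (fun t => level d γ t τ / Real.log t) atTop (𝓝 d) := by
  have h1 := ((tendsto_log_scale_div_log γ).const_mul (d : ℝ)).sub
    (tendsto_const_nhds (x := Real.log (τ * normConst d γ))|>.div_atTop Real.tendsto_log_atTop)
  simp only [mul_one, sub_zero] at h1
  refine h1.congr' ?_
  filter_upwards [eventually_gt_atTop (Real.exp 1)] with t ht
  have hD := normConst_pos d γ
  have hr := scale_pos (γ := γ) ht
  unfold level
  rw [Real.log_div (by positivity) (by positivity), Real.log_pow]
  ring

lemma tendsto_level_atTop (d : ℕ) [NeZero d] (γ : ℝ) {τ : ℝ} (hτ : 0 < τ) :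
    Tendsto (fun t => level d γ t τ) atTop atTop := by
  have hd : (0 : ℝ) < d := by exact_mod_cast Nat.pos_of_ne_zero (NeZero.ne d)
  refine ((tendsto_level_div_log d γ hτ).pos_mul_atTop hd Real.tendsto_log_atTop).congr' ?_
  filter_upwards [eventually_gt_atTop (Real.exp 1)] with t ht
  have h1 : 1 < Real.log t := (Real.lt_log_iff_exp_lt ((Real.exp_pos 1).trans ht)).2 ht
  field_simp

/-- The tilting rate at the given level. -/
def slopeRate (d : ℕ) (γ t τ : ℝ) : ℝ :=
  level d γ t τ ^ (1 - 1 / γ) * (Real.log t ^ (1 / γ - 1) / γ)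

lemma tendsto_slopeRate (d : ℕ) [NeZero d] (γ : ℝ) {τ : ℝ} (hτ : 0 < τ) :
    Tendsto (fun t => slopeRate d γ t τ) atTop (𝓝 ((d : ℝ) ^ (1 - 1 / γ) / γ)) := by
  have hd : (0 : ℝ) < d := by exact_mod_cast Nat.pos_of_ne_zero (NeZero.ne d)
  refine (((tendsto_level_div_log d γ hτ).rpow_const (p := 1 - 1 / γ)
    (Or.inl hd.ne')).div_const γ).congr' ?_
  filter_upwards [eventually_gt_atTop (Real.exp 1),
    (tendsto_level_atTop d γ hτ).eventually_gt_atTop 0] with t ht hA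
  have h1 : 1 < Real.log t := (Real.lt_log_iff_exp_lt ((Real.exp_pos 1).trans ht)).2 ht
  have h3 : 0 < Real.log t := by linarith
  unfold slopeRate
  rw [Real.div_rpow hA.le h3.le, show 1 / γ - 1 = -(1 - 1 / γ) by ring, Real.rpow_neg h3.le]
  field_simp

/-! ### The Weibull tail at the tilted level: limit and uniform bound. -/

lemma tendsto_mul_one_add_div_rpow_sub {ι : Type*} {l : Filter ι} (γ : ℝ) {A w : ι → ℝ} {w₀ : ℝ}
    (hA : Tendsto A l atTop) (hw : Tendsto w l (𝓝 w₀)) :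
    Tendsto (fun i => A i * (1 + w i / A i) ^ γ - A i) l (𝓝 (γ * w₀)) := by
  have hd : HasDerivAt (fun x : ℝ => x ^ γ) γ 1 := by
    simpa using Real.hasDerivAt_rpow_const (x := 1) (p := γ) (Or.inl one_ne_zero)
  have h1 : Tendsto (fun i => 1 + w i / A i) l (𝓝 1) := by
    simpa using (tendsto_const_nhds (x := (1 : ℝ))).add (hw.div_atTop hA)
  -- `dslope` makes the difference quotient exact even where `w i = 0`.
  have h2 : Tendsto (fun i => dslope (fun x : ℝ => x ^ γ) 1 (1 + w i / A i)) l (𝓝 γ) := by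
    have := (continuousAt_dslope_same.2 hd.differentiableAt).tendsto.comp h1
    simpa [dslope_same, hd.deriv, Function.comp_def] using this
  refine (h2.mul hw).congr' ?_
  filter_upwards [hA.eventually_gt_atTop 0] with i hi
  have := sub_smul_dslope (fun x : ℝ => x ^ γ) 1 (1 + w i / A i)
  simp only [smul_eq_mul, Real.one_rpow, add_sub_cancel_left] at this
  have h3 : A i * (1 + w i / A i) ^ γ - A i =
      A i * (w i / A i * dslope (fun x : ℝ => x ^ γ) 1 (1 + w i / A i)) := by
    rw [this]; ring
  rw [h3]
  field_simp

/-- Combines `x^γ - 1 ≥ γ log x` with the monotonicity of `A ↦ A log(1 + w/A)`, which is Bernoulli's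
inequality. Bounding by a logarithm works for every `γ > 0`; for `γ < 1` the power is concave and no
linear bound in `w` is available. -/
lemma one_add_rpow_sub_ge {γ m A w : ℝ} (hγ : 0 < γ) (hm : 0 < m) (hA : m ≤ A) (hw : 0 ≤ w) :
    γ * m * Real.log (1 + w / m) ≤ A * (1 + w / A) ^ γ - A := by
  have hA0 : 0 < A := hm.trans_le hA
  have h1 : m * Real.log (1 + w / m) ≤ A * Real.log (1 + w / A) := by
    have hb := one_add_mul_self_le_rpow_one_add (s := w / A)
      (by have : 0 ≤ w / A := by positivity
          linarith) (p := A / m) ((one_le_div hm).2 hA)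
    have e : A / m * (w / A) = w / m := by field_simp
    rw [e] at hb
    have hl := Real.log_le_log (by positivity) hb
    rw [Real.log_rpow (by positivity)] at hl
    calc m * Real.log (1 + w / m) ≤ m * (A / m * Real.log (1 + w / A)) := by gcongr
      _ = _ := by field_simp
  have h2 : γ * Real.log (1 + w / A) ≤ (1 + w / A) ^ γ - 1 := by
    rw [← Real.log_rpow (by positivity)]
    exact Real.log_le_sub_one_of_pos (by positivity)
  calc γ * m * Real.log (1 + w / m) = γ * (m * Real.log (1 + w / m)) := by ring
    _ ≤ γ * (A * Real.log (1 + w / A)) := by gcongr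
    _ = A * (γ * Real.log (1 + w / A)) := by ring
    _ ≤ A * ((1 + w / A) ^ γ - 1) := by gcongr
    _ = _ := by ring

/-- The tail probability of the potential at the tilted level, at distance `v * r_t` from the
origin, multiplied by the number `r_t ^ d` of sites. -/
def scaledTail (d : ℕ) (γ t τ v : ℝ) : ℝ :=
  scale γ t ^ d * Real.exp (-(level d γ t τ ^ (1 / γ) + Real.log t ^ (1 / γ - 1) / γ * v) ^ γ)

/-- Pulling `A^(1/γ)` out of the bracket leaves `A * (1 + s v / A)^γ`, with `s` the slope rate, and
`exp(-A)` cancels the factor `r_t^d`. -/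
lemma scaledTail_eq (d : ℕ) [NeZero d] {γ t τ v : ℝ} (hγ : 0 < γ) (ht : Real.exp 1 < t)
    (hτ : 0 < τ) (hv : 0 ≤ v) (hA : 0 < level d γ t τ) :
    scaledTail d γ t τ v = τ * normConst d γ * Real.exp (-(level d γ t τ *
      (1 + slopeRate d γ t τ * v / level d γ t τ) ^ γ - level d γ t τ)) := by
  have hD := normConst_pos d γ
  have hr := scale_pos (γ := γ) ht
  have h1 : 1 < Real.log t := (Real.lt_log_iff_exp_lt ((Real.exp_pos 1).trans ht)).2 ht
  have h3 : 0 < Real.log t := by linarith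
  have key : (level d γ t τ ^ (1 / γ) + Real.log t ^ (1 / γ - 1) / γ * v) ^ γ =
      level d γ t τ * (1 + slopeRate d γ t τ * v / level d γ t τ) ^ γ := by
    set A := level d γ t τ with hAdef
    have e : A ^ (1 / γ) + Real.log t ^ (1 / γ - 1) / γ * v =
        A ^ (1 / γ) * (1 + slopeRate d γ t τ * v / A) := by
      have : A ^ (1 / γ) * A ^ (1 - 1 / γ) = A := by
        rw [← Real.rpow_add hA]; simp
      unfold slopeRate
      rw [← hAdef, mul_add, mul_one]
      congr 1
      calc _ = A * (Real.log t ^ (1 / γ - 1) / γ * v) / A := by field_simp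
        _ = A ^ (1 / γ) * A ^ (1 - 1 / γ) * (Real.log t ^ (1 / γ - 1) / γ * v) / A := by rw [this]
        _ = _ := by ring
    have hs : 0 ≤ slopeRate d γ t τ := by unfold slopeRate; positivity
    rw [e, Real.mul_rpow (by positivity) (by positivity), ← Real.rpow_mul hA.le,
      one_div_mul_cancel hγ.ne', Real.rpow_one]
  have hexp : Real.exp (-level d γ t τ) = τ * normConst d γ / scale γ t ^ d := by
    unfold level
    rw [Real.exp_neg, Real.exp_log (by positivity), inv_div]
  unfold scaledTail
  rw [key, neg_sub, sub_eq_add_neg, Real.exp_add, ← mul_assoc]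
  congr 1
  rw [Real.exp_neg, inv_eq_iff_eq_inv] at hexp
  rw [hexp, inv_div]
  field_simp

lemma tendsto_scaledTail (d : ℕ) [NeZero d] {γ τ : ℝ} (hγ : 0 < γ) (hτ : 0 < τ)
    {v : ℝ → ℝ} {v₀ : ℝ} (hv : ∀ t, 0 ≤ v t) (hv₀ : Tendsto v atTop (𝓝 v₀)) :
    Tendsto (fun t => scaledTail d γ t τ (v t)) atTop
      (𝓝 (τ * (normConst d γ * Real.exp (-((d : ℝ) ^ (1 - 1 / γ) * v₀))))) := by
  have h := tendsto_mul_one_add_div_rpow_sub γ (tendsto_level_atTop d γ hτ)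
    ((tendsto_slopeRate d γ hτ).mul hv₀)
  have h2 := ((Real.continuous_exp.tendsto _).comp h.neg).const_mul (τ * normConst d γ)
  have e : γ * ((d : ℝ) ^ (1 - 1 / γ) / γ * v₀) = (d : ℝ) ^ (1 - 1 / γ) * v₀ := by field_simp
  rw [e, mul_assoc] at h2
  refine h2.congr' ?_
  filter_upwards [eventually_gt_atTop (Real.exp 1),
    (tendsto_level_atTop d γ hτ).eventually_gt_atTop 0] with t ht hA
  rw [scaledTail_eq d hγ ht hτ (hv t) hA]
  rfl

lemma scaledTail_le (d : ℕ) [NeZero d] {γ τ : ℝ} (hγ : 0 < γ) (hτ : 0 < τ) :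
    ∃ k : ℝ, 0 < k ∧ ∀ᶠ t in atTop, ∀ v : ℝ, 0 ≤ v →
      scaledTail d γ t τ v ≤ τ * normConst d γ * (1 + k * v) ^ (-((d : ℝ) + 1)) := by
  have hd : (0 : ℝ) < d := by exact_mod_cast Nat.pos_of_ne_zero (NeZero.ne d)
  have hD := normConst_pos d γ
  -- Chosen so that `γ * m = d + 1`, a decay exponent integrable on `ℝ^d`.
  set m : ℝ := ((d : ℝ) + 1) / γ with hm
  have hm0 : 0 < m := by positivity
  set κ : ℝ := (d : ℝ) ^ (1 - 1 / γ) / γ / 2 with hκ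
  have hκ0 : 0 < κ := by positivity
  refine ⟨κ / m, by positivity, ?_⟩
  filter_upwards [eventually_gt_atTop (Real.exp 1),
    (tendsto_level_atTop d γ hτ).eventually_ge_atTop m,
    (tendsto_slopeRate d γ hτ).eventually_const_le
      (show κ < (d : ℝ) ^ (1 - 1 / γ) / γ from half_lt_self (by positivity))] with t ht hA hs v hv
  rw [scaledTail_eq d hγ ht hτ hv (hm0.trans_le hA)]
  refine mul_le_mul_of_nonneg_left ?_ (by positivity)
  have h1 := one_add_rpow_sub_ge (w := slopeRate d γ t τ * v) hγ hm0 hA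
    (mul_nonneg (hκ0.le.trans hs) hv)
  have h2 : Real.log (1 + κ / m * v) ≤ Real.log (1 + slopeRate d γ t τ * v / m) := by
    apply Real.log_le_log (by positivity)
    rw [div_mul_eq_mul_div]
    gcongr
  rw [Real.rpow_def_of_pos (show 0 < 1 + κ / m * v by positivity)]
  apply Real.exp_le_exp.2
  have e : γ * m = d + 1 := by rw [hm]; field_simp
  rw [e] at h1
  have : ((d : ℝ) + 1) * Real.log (1 + κ / m * v) ≤
      (d + 1) * Real.log (1 + slopeRate d γ t τ * v / m) := by gcongr
  linarith

/-! ### Lattice sums as integrals, and the expected number of exceedances. -/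

/-- The lattice cell of `x` when `ℝ^d` is cut into cubes of side `1 / r`. -/
def gridPoint {d : ℕ} (r : ℝ) (x : Fin d → ℝ) : Fin d → ℤ := fun i => ⌊r * x i⌋

/-- The lattice point `z` on the spatial scale `r`. -/
def rescale {d : ℕ} (r : ℝ) (z : Fin d → ℤ) : Fin d → ℝ := fun i => (z i : ℝ) / r

lemma measurable_gridPoint {d : ℕ} (r : ℝ) : Measurable (gridPoint (d := d) r) := by
  unfold gridPoint
  fun_prop

lemma map_gridPoint (d : ℕ) {r : ℝ} (hr : 0 < r) :
    (volume : Measure (Fin d → ℝ)).map (gridPoint r) =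
      ENNReal.ofReal (r⁻¹ ^ d) • Measure.count := by
  refine Measure.ext_of_singleton fun z => ?_
  rw [Measure.map_apply (measurable_gridPoint r) (measurableSet_singleton z)]
  have e : gridPoint r ⁻¹' {z} =
      Set.pi Set.univ fun i => Set.Ico ((z i : ℝ) / r) (((z i : ℝ) + 1) / r) := by
    ext x
    simp only [Set.mem_preimage, Set.mem_singleton_iff, Set.mem_pi, Set.mem_univ, forall_const,
      Set.mem_Ico, funext_iff, gridPoint, Int.floor_eq_iff, div_le_iff₀ hr, lt_div_iff₀ hr,
      mul_comm r]
  rw [e, Real.volume_pi_Ico]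
  have (i : Fin d) : ((z i : ℝ) + 1) / r - z i / r = r⁻¹ := by field_simp; ring
  simp only [this, Finset.prod_const, Finset.card_univ, Fintype.card_fin, Measure.smul_apply,
    Measure.count_singleton, smul_eq_mul, mul_one, ENNReal.ofReal_pow (inv_nonneg.2 hr.le)]

/-- Each cell has volume `r^(-d)`. An exact integral, rather than an approximating Riemann sum, lets
dominated convergence apply on the whole of `ℝ^d`. -/
lemma tsum_eq_lintegral_gridPoint {d : ℕ} {r : ℝ} (hr : 0 < r) (g : (Fin d → ℤ) → ℝ≥0∞) :
    ∑' z, g z = ∫⁻ x : Fin d → ℝ, ENNReal.ofReal (r ^ d) * g (gridPoint r x) := by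
  have h := lintegral_map (μ := (volume : Measure (Fin d → ℝ))) (f := g)
    (measurable_of_countable g) (measurable_gridPoint r)
  rw [map_gridPoint d hr, lintegral_smul_measure, lintegral_count] at h
  rw [lintegral_const_mul _ (f := fun x => g (gridPoint r x))
    ((measurable_of_countable g).comp (measurable_gridPoint r)), ← h,
    smul_eq_mul, ← mul_assoc, ← ENNReal.ofReal_mul (by positivity), ← mul_pow,
    mul_inv_cancel₀ hr.ne', one_pow, ENNReal.ofReal_one, one_mul]

lemma abs_floor_div_sub_le {r : ℝ} (hr : 0 < r) (x : ℝ) : |(⌊r * x⌋ : ℝ) / r - x| ≤ 1 / r := by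
  have h1 := Int.floor_le (r * x)
  have h2 := Int.lt_floor_add_one (r * x)
  have e : (⌊r * x⌋ : ℝ) / r - x = (⌊r * x⌋ - r * x) / r := by field_simp
  rw [e, abs_div, abs_of_pos hr]
  gcongr
  rw [abs_le]
  constructor <;> linarith

lemma norm_rescale_gridPoint_sub_le {d : ℕ} {r : ℝ} (hr : 0 < r) (x : Fin d → ℝ) :
    ‖rescale r (gridPoint r x) - x‖ ≤ 1 / r :=
  (pi_norm_le_iff_of_nonneg (by positivity)).2 fun i => abs_floor_div_sub_le hr (x i)

lemma tendsto_rescale_gridPoint {d : ℕ} {ι : Type*} {l : Filter ι} {r : ι → ℝ}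
    (hr : Tendsto r l atTop) (x : Fin d → ℝ) :
    Tendsto (fun i => rescale (r i) (gridPoint (r i) x)) l (𝓝 x) := by
  rw [tendsto_iff_norm_sub_tendsto_zero]
  refine squeeze_zero' (Eventually.of_forall fun _ => norm_nonneg _) ?_
    ((tendsto_const_nhds (x := (1 : ℝ))).div_atTop hr)
  filter_upwards [hr.eventually_gt_atTop 0] with i hi using norm_rescale_gridPoint_sub_le hi x

lemma norm_le_sum_abs {d : ℕ} (y : Fin d → ℝ) : ‖y‖ ≤ ∑ i, |y i| :=
  (pi_norm_le_iff_of_nonneg (Finset.sum_nonneg fun _ _ => abs_nonneg _)).2 fun i =>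
    Finset.single_le_sum (f := fun i => |y i|) (fun _ _ => abs_nonneg _) (Finset.mem_univ i)

lemma tendsto_scale_atTop (γ : ℝ) : Tendsto (scale γ) atTop atTop := by
  have h := (tendsto_log_scale_div_log γ).pos_mul_atTop one_pos Real.tendsto_log_atTop
  refine (Real.tendsto_exp_atTop.comp h).congr' ?_
  filter_upwards [eventually_gt_atTop (Real.exp 1)] with t ht
  have h1 : 1 < Real.log t := (Real.lt_log_iff_exp_lt ((Real.exp_pos 1).trans ht)).2 ht
  have h3 : Real.log t ≠ 0 := by positivity
  simp only [Function.comp, div_mul_cancel₀ _ h3, Real.exp_log (scale_pos ht)]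

/-- The tilted threshold at `z` for the level with parameter `τ`. -/
def threshold {d : ℕ} (γ t τ : ℝ) (z : Fin d → ℤ) : ℝ :=
  level d γ t τ ^ (1 / γ) + latticeNorm z / (γ * t) * Real.log (Real.log t)

lemma latticeNorm_mul_eq {d : ℕ} {γ t : ℝ} (hγ : 0 < γ) (ht : Real.exp 1 < t) (z : Fin d → ℤ) :
    latticeNorm z / (γ * t) * Real.log (Real.log t) =
      Real.log t ^ (1 / γ - 1) / γ * ∑ i, |rescale (scale γ t) z i| := by
  have h0 : 0 < t := (Real.exp_pos 1).trans ht
  have h1 : 1 < Real.log t := (Real.lt_log_iff_exp_lt h0).2 ht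
  have h2 : 0 < Real.log (Real.log t) := Real.log_pos h1
  have h3 : 0 < Real.log t := by linarith
  have h4 : 0 < Real.log t ^ (1 / γ - 1) := by positivity
  have e : ∑ i, |rescale (scale γ t) z i| = latticeNorm z / scale γ t := by
    simp only [rescale, abs_div, abs_of_pos (scale_pos (γ := γ) ht), latticeNorm, Finset.sum_div]
  rw [e]
  unfold scale
  set P := Real.log t ^ (1 / γ - 1)
  field_simp

lemma scale_pow_mul_exp_threshold {d : ℕ} {γ t τ : ℝ} (hγ : 0 < γ) (ht : Real.exp 1 < t)
    (z : Fin d → ℤ) :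
    scale γ t ^ d * Real.exp (-threshold γ t τ z ^ γ) =
      scaledTail d γ t τ (∑ i, |rescale (scale γ t) z i|) := by
  unfold threshold scaledTail
  rw [latticeNorm_mul_eq hγ ht]

lemma measurable_limitDensity (d : ℕ) (γ : ℝ) : Measurable (limitDensity d γ) := by
  unfold limitDensity
  fun_prop

lemma measurable_scaledTail (d : ℕ) (γ t τ : ℝ) : Measurable (scaledTail d γ t τ) := by
  unfold scaledTail
  fun_prop

lemma tendsto_indicator_of_notMem_frontier {X ι : Type*} [TopologicalSpace X] {l : Filter ι}
    {B : Set X} {x : X} (hx : x ∉ frontier B) {y : ι → X} (hy : Tendsto y l (𝓝 x))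
    {f : ι → X → ℝ≥0∞} {a : X → ℝ≥0∞} (hf : Tendsto (fun i => f i (y i)) l (𝓝 (a x))) :
    Tendsto (fun i => B.indicator (f i) (y i)) l (𝓝 (B.indicator a x)) := by
  by_cases hB : x ∈ B
  · have hi : x ∈ interior B := by
      by_contra h
      exact hx ⟨subset_closure hB, h⟩
    rw [Set.indicator_of_mem hB]
    refine hf.congr' ?_
    filter_upwards [hy.eventually (mem_interior_iff_mem_nhds.1 hi)] with i hi
    rw [Set.indicator_of_mem hi]
  · have hi : x ∉ closure B := fun h => hx ⟨h, fun h' => hB (interior_subset h')⟩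
    rw [Set.indicator_of_notMem hB]
    refine tendsto_const_nhds.congr' ?_
    filter_upwards [hy.eventually (isClosed_closure.isOpen_compl.mem_nhds hi)] with i hi
    rw [Set.indicator_of_notMem fun h => hi (subset_closure h)]

lemma exists_scaledTail_rescale_gridPoint_le (d : ℕ) [NeZero d] {γ τ : ℝ} (hγ : 0 < γ)
    (hτ : 0 < τ) : ∃ C : ℝ, ∀ᶠ t in atTop, ∀ x : Fin d → ℝ,
      scaledTail d γ t τ (∑ i, |rescale (scale γ t) (gridPoint (scale γ t) x) i|) ≤
        C * (1 + ‖x‖) ^ (-((d : ℝ) + 1)) := by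
  obtain ⟨k, hk, hle⟩ := scaledTail_le d hγ hτ
  have hD := normConst_pos d γ
  -- With `v ≥ ‖x‖ - 1`, this gives `k' * (1 + ‖x‖) ≤ 2 * k' + k' * v ≤ 1 + k * v`.
  set k' : ℝ := min k 1 / 2 with hk'
  have hk0 : 0 < k' := by positivity
  refine ⟨τ * normConst d γ * k' ^ (-((d : ℝ) + 1)), ?_⟩
  filter_upwards [hle, (tendsto_scale_atTop γ).eventually_ge_atTop 1] with t ht hr x
  set v := ∑ i, |rescale (scale γ t) (gridPoint (scale γ t) x) i| with hv
  have hv0 : 0 ≤ v := Finset.sum_nonneg fun _ _ => abs_nonneg _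
  refine (ht v hv0).trans ?_
  rw [mul_assoc _ (k' ^ _), ← Real.mul_rpow hk0.le (by positivity)]
  refine mul_le_mul_of_nonneg_left ?_ (by positivity)
  refine Real.rpow_le_rpow_of_nonpos (by positivity) ?_ (by linarith [(d.cast_nonneg : (0:ℝ) ≤ d)])
  have h1 : ‖x‖ - 1 ≤ v := by
    have h2 := norm_rescale_gridPoint_sub_le (zero_lt_one.trans_le hr) x
    have h3 := norm_le_sum_abs (rescale (scale γ t) (gridPoint (scale γ t) x))
    have h4 : 1 / scale γ t ≤ 1 := by
      rw [div_le_one (by linarith)]; exact hr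
    have h5 := norm_sub_norm_le x (rescale (scale γ t) (gridPoint (scale γ t) x))
    rw [norm_sub_rev] at h5
    linarith
  have h2 : 2 * k' ≤ k := by rw [hk']; linarith [min_le_left k 1]
  have h3 : 2 * k' ≤ 1 := by rw [hk']; linarith [min_le_right k 1]
  nlinarith

/-- The expected number of rescaled sites in `B` at which the tilted potential exceeds the level
with parameter `τ` converges to `τ` times the mass of `B`. -/
lemma tendsto_tsum_tail (d : ℕ) [NeZero d] {γ τ : ℝ} (hγ : 0 < γ) (hτ : 0 < τ)
    {B : Set (Fin d → ℝ)} (hB : MeasurableSet B) (hB0 : volume (frontier B) = 0) :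
    Tendsto (fun t => ∑' z : Fin d → ℤ, B.indicator
        (fun _ => ENNReal.ofReal (Real.exp (-threshold γ t τ z ^ γ))) (rescale (scale γ t) z))
      atTop (𝓝 (ENNReal.ofReal τ *
        (volume : Measure (Fin d → ℝ)).withDensity
          (fun x => ENNReal.ofReal (limitDensity d γ x)) B)) := by
  obtain ⟨C, hC⟩ := exists_scaledTail_rescale_gridPoint_le d hγ hτ
  have hlim : ENNReal.ofReal τ * (volume : Measure (Fin d → ℝ)).withDensity
      (fun x => ENNReal.ofReal (limitDensity d γ x)) B =
      ∫⁻ x, B.indicator (fun x => ENNReal.ofReal (τ * limitDensity d γ x)) x := by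
    rw [lintegral_indicator hB, withDensity_apply _ hB, ← lintegral_const_mul]
    · simp_rw [ENNReal.ofReal_mul hτ.le]
    · exact (measurable_limitDensity d γ).ennreal_ofReal
  rw [hlim]
  have hint : ∫⁻ x : Fin d → ℝ, ENNReal.ofReal (C * (1 + ‖x‖) ^ (-((d : ℝ) + 1))) ≠ ∞ := by
    have := (integrable_one_add_norm (E := Fin d → ℝ) (μ := volume) (r := (d : ℝ) + 1)
      (by simp)).const_mul C
    exact this.lintegral_lt_top.ne
  refine (tendsto_lintegral_filter_of_dominated_convergence (F := fun t x =>
    B.indicator (fun y => ENNReal.ofReal (scaledTail d γ t τ (∑ i, |y i|)))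
      (rescale (scale γ t) (gridPoint (scale γ t) x))) _ ?_ ?_ hint ?_).congr' ?_
  · refine Eventually.of_forall fun t => ?_
    have h1 : Measurable (B.indicator fun y =>
        ENNReal.ofReal (scaledTail d γ t τ (∑ i, |y i|))) :=
      (((measurable_scaledTail d γ t τ).comp (by fun_prop)).ennreal_ofReal).indicator hB
    exact h1.comp ((measurable_of_countable (rescale (scale γ t))).comp (measurable_gridPoint _))
  · filter_upwards [hC] with t ht
    refine Eventually.of_forall fun x => (Set.indicator_le_self' (by simp) _).trans ?_
    exact ENNReal.ofReal_le_ofReal (ht x)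
  -- Off the frontier of `B`, the rounded point eventually lies on the same side of `B` as `x`.
  · filter_upwards [(measure_eq_zero_iff_ae_notMem.1 hB0)] with x hx
    have hy := tendsto_rescale_gridPoint (tendsto_scale_atTop γ) x
    refine tendsto_indicator_of_notMem_frontier hx hy ?_
    refine (ENNReal.continuous_ofReal.tendsto _).comp ?_
    rw [limitDensity_eq]
    refine tendsto_scaledTail d hγ hτ (fun t => Finset.sum_nonneg fun _ _ => abs_nonneg _) ?_
    exact tendsto_finsetSum _ fun i _ => ((tendsto_pi_nhds.1 hy) i).abs
  · filter_upwards [eventually_gt_atTop (Real.exp 1)] with t ht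
    rw [tsum_eq_lintegral_gridPoint (scale_pos (γ := γ) ht)]
    refine lintegral_congr fun x => ?_
    by_cases h : rescale (scale γ t) (gridPoint (scale γ t) x) ∈ B
    · rw [Set.indicator_of_mem h, Set.indicator_of_mem h,
        ← ENNReal.ofReal_mul (pow_nonneg (scale_pos ht).le _), scale_pow_mul_exp_threshold hγ ht]
    · rw [Set.indicator_of_notMem h, Set.indicator_of_notMem h, mul_zero]

/-! ### Poisson approximation for the absence of exceedances. -/

lemma exp_neg_le_one_sub {p ε : ℝ} (hp : 0 ≤ p) (hpε : p ≤ ε) (hε : ε ≤ 1 / 2) :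
    Real.exp (-((1 + 2 * ε) * p)) ≤ 1 - p := by
  have h1 : 0 < 1 - p := by linarith
  rw [Real.exp_neg, inv_le_comm₀ (Real.exp_pos _) h1]
  have h2 : (1 - p)⁻¹ ≤ 1 + (1 + 2 * ε) * p := by
    rw [inv_le_iff_one_le_mul₀ h1]
    have h3 : 0 ≤ p * (ε - p) := mul_nonneg hp (by linarith)
    have h4 : 0 ≤ p * p * (1 / 2 - ε) := mul_nonneg (mul_nonneg hp hp) (by linarith)
    nlinarith
  linarith [Real.add_one_le_exp ((1 + 2 * ε) * p)]

section

variable {Ω : Type*} [MeasurableSpace Ω] {P : Measure Ω} [IsProbabilityMeasure P] {d : ℕ} {γ : ℝ}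
  {ξ : (Fin d → ℤ) → Ω → ℝ}

lemma IsWeibullPotential.measure_le (hξ : IsWeibullPotential γ ξ P) (z : Fin d → ℤ) {θ : ℝ}
    (hθ : 0 ≤ θ) : P {ω | θ ≤ ξ z ω} = ENNReal.ofReal (Real.exp (-θ ^ γ)) := by
  have e : {ω | θ ≤ ξ z ω} = {ω | ξ z ω < θ}ᶜ := by ext; simp
  have hle : Real.exp (-θ ^ γ) ≤ 1 := Real.exp_le_one_iff.2 (by have := Real.rpow_nonneg hθ γ; linarith)
  rw [e, prob_compl_eq_one_sub (measurableSet_lt (hξ.measurable z) measurable_const),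
    hξ.distrib z θ hθ, ← ENNReal.ofReal_one, ← ENNReal.ofReal_sub _ (by linarith)]
  congr 1
  ring

lemma IsWeibullPotential.tendsto_prod (hξ : IsWeibullPotential γ ξ P) {θ : (Fin d → ℤ) → ℝ}
    (hθ : ∀ z, 0 ≤ θ z) :
    Tendsto (fun S : Finset (Fin d → ℤ) => ∏ z ∈ S, (1 - Real.exp (-θ z ^ γ))) atTop
      (𝓝 (P.real {ω | ∀ z, ξ z ω < θ z})) := by
  have hm : ∀ S : Finset (Fin d → ℤ), MeasurableSet (⋂ z ∈ S, {ω | ξ z ω < θ z}) := fun S =>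
    S.measurableSet_biInter fun z _ => measurableSet_lt (hξ.measurable z) measurable_const
  have h := tendsto_measure_iInter_atTop (μ := P)
    (s := fun S : Finset (Fin d → ℤ) => ⋂ z ∈ S, {ω | ξ z ω < θ z})
    (fun S => (hm S).nullMeasurableSet)
    (fun S T hST => Set.biInter_subset_biInter_left hST) ⟨∅, measure_ne_top _ _⟩
  have e : (⋂ S : Finset (Fin d → ℤ), ⋂ z ∈ S, {ω | ξ z ω < θ z}) = {ω | ∀ z, ξ z ω < θ z} := by
    ext ω
    simp only [Set.mem_iInter, Set.mem_ofPred_eq]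
    exact ⟨fun h z => h {z} z (Finset.mem_singleton_self z), fun h S z _ => h z⟩
  rw [e] at h
  refine ((ENNReal.tendsto_toReal (measure_ne_top _ _)).comp h).congr fun S => ?_
  simp only [Function.comp]
  rw [hξ.indep.meas_biInter (s := fun z => {ω | ξ z ω < θ z})
    (fun z _ => ⟨Set.Iio (θ z), measurableSet_Iio, rfl⟩), ENNReal.toReal_prod]
  refine Finset.prod_congr rfl fun z _ => ?_
  rw [hξ.distrib z _ (hθ z), ENNReal.toReal_ofReal]
  have : Real.exp (-θ z ^ γ) ≤ 1 :=
    Real.exp_le_one_iff.2 (by have := Real.rpow_nonneg (hθ z) γ; linarith)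
  linarith

/-- Multiply `exp(-(1+2ε)p) ≤ 1 - p ≤ exp(-p)` over finite sets of sites and pass to the limit. -/
lemma IsWeibullPotential.measureReal_forall_lt_bounds (hξ : IsWeibullPotential γ ξ P)
    {θ : (Fin d → ℤ) → ℝ} (hθ : ∀ z, 0 ≤ θ z) {ε : ℝ} (hε : ε ≤ 1 / 2)
    (hp : ∀ z, Real.exp (-θ z ^ γ) ≤ ε)
    (hs : ∑' z, ENNReal.ofReal (Real.exp (-θ z ^ γ)) ≠ ∞) :
    Real.exp (-((1 + 2 * ε) * (∑' z, ENNReal.ofReal (Real.exp (-θ z ^ γ))).toReal)) ≤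
        P.real {ω | ∀ z, ξ z ω < θ z} ∧
      P.real {ω | ∀ z, ξ z ω < θ z} ≤
        Real.exp (-(∑' z, ENNReal.ofReal (Real.exp (-θ z ^ γ))).toReal) := by
  have hsum : HasSum (fun z => Real.exp (-θ z ^ γ))
      (∑' z, ENNReal.ofReal (Real.exp (-θ z ^ γ))).toReal := by
    have := ENNReal.hasSum_toReal hs
    rw [← ENNReal.tsum_toReal_eq fun _ => ENNReal.ofReal_ne_top] at this
    simpa only [ENNReal.toReal_ofReal (Real.exp_nonneg _)] using this
  have h := hξ.tendsto_prod hθ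
  constructor
  · have h1 : Tendsto (fun S : Finset (Fin d → ℤ) =>
        Real.exp (-((1 + 2 * ε) * ∑ z ∈ S, Real.exp (-θ z ^ γ)))) atTop _ :=
      (Real.continuous_exp.tendsto _).comp ((Tendsto.const_mul (1 + 2 * ε) hsum).neg)
    refine le_of_tendsto_of_tendsto' h1 h fun S => ?_
    rw [Finset.mul_sum, ← Finset.sum_neg_distrib, Real.exp_sum]
    exact Finset.prod_le_prod (fun _ _ => Real.exp_nonneg _)
      fun z _ => exp_neg_le_one_sub (Real.exp_nonneg _) (hp z) hε
  · have h1 : Tendsto (fun S : Finset (Fin d → ℤ) =>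
        Real.exp (-∑ z ∈ S, Real.exp (-θ z ^ γ))) atTop _ :=
      (Real.continuous_exp.tendsto _).comp (Tendsto.neg hsum)
    refine le_of_tendsto_of_tendsto' h h1 fun S => ?_
    rw [← Finset.sum_neg_distrib, Real.exp_sum]
    refine Finset.prod_le_prod (fun z _ => by linarith [hp z]) fun z _ => ?_
    linarith [Real.add_one_le_exp (-Real.exp (-θ z ^ γ))]

/-- Poisson approximation: if the exceedance probabilities are uniformly small and their sum
converges to `Λ`, then the probability of no exceedance converges to `exp (-Λ)`. -/
lemma IsWeibullPotential.tendsto_measureReal_forall_lt (hξ : IsWeibullPotential γ ξ P)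
    {ι : Type*} {l : Filter ι} {θ : ι → (Fin d → ℤ) → ℝ} (hθ : ∀ᶠ i in l, ∀ z, 0 ≤ θ i z)
    {ε : ι → ℝ} (hε : Tendsto ε l (𝓝 0)) (hp : ∀ᶠ i in l, ∀ z, Real.exp (-θ i z ^ γ) ≤ ε i)
    {Λ : ℝ≥0∞} (hΛ : Λ ≠ ∞)
    (hs : Tendsto (fun i => ∑' z, ENNReal.ofReal (Real.exp (-θ i z ^ γ))) l (𝓝 Λ)) :
    Tendsto (fun i => P.real {ω | ∀ z, ξ z ω < θ i z}) l (𝓝 (Real.exp (-Λ.toReal))) := by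
  have hs' := (ENNReal.tendsto_toReal hΛ).comp hs
  have hlow : Tendsto (fun i => Real.exp (-((1 + 2 * ε i) *
      (∑' z, ENNReal.ofReal (Real.exp (-θ i z ^ γ))).toReal))) l (𝓝 (Real.exp (-Λ.toReal))) := by
    have h1 : Tendsto (fun i => -((1 + 2 * ε i) *
        (∑' z, ENNReal.ofReal (Real.exp (-θ i z ^ γ))).toReal)) l
        (𝓝 (-((1 + 2 * 0) * Λ.toReal))) :=
      (((hε.const_mul 2).const_add 1).mul hs').neg
    simp only [mul_zero, add_zero, one_mul] at h1
    exact (Real.continuous_exp.tendsto _).comp h1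
  have hup := (Real.continuous_exp.tendsto _).comp hs'.neg
  have hb := (hθ.and hp).and ((hε.eventually_le_const
    (show (0 : ℝ) < 1 / 2 by norm_num)).and (hs.eventually_ne hΛ))
  exact tendsto_of_tendsto_of_tendsto_of_le_of_le' hlow hup
    (hb.mono fun i h => (hξ.measureReal_forall_lt_bounds h.1.1 h.2.1 h.1.2 h.2.2).1)
    (hb.mono fun i h => (hξ.measureReal_forall_lt_bounds h.1.1 h.2.1 h.1.2 h.2.2).2)

end

lemma latticeNorm_nonneg {d : ℕ} (z : Fin d → ℤ) : 0 ≤ latticeNorm z :=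
  Finset.sum_nonneg fun _ _ => abs_nonneg _

lemma level_rpow_le_threshold {d : ℕ} {γ t τ : ℝ} (hγ : 0 < γ) (ht : Real.exp 1 < t)
    (z : Fin d → ℤ) : level d γ t τ ^ (1 / γ) ≤ threshold γ t τ z := by
  have h0 : 0 < t := (Real.exp_pos 1).trans ht
  have h1 : 1 < Real.log t := (Real.lt_log_iff_exp_lt h0).2 ht
  have h2 : 0 < Real.log (Real.log t) := Real.log_pos h1
  have := latticeNorm_nonneg z
  unfold threshold
  have : 0 ≤ latticeNorm z / (γ * t) * Real.log (Real.log t) := by positivity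
  linarith

/-- The law of the maximum of the tilted potential, over `B` and its complement jointly. -/
lemma IsWeibullPotential.tendsto_measureReal_forall_lt_threshold {Ω : Type*} [MeasurableSpace Ω]
    {P : Measure Ω} [IsProbabilityMeasure P] {d : ℕ} [NeZero d] {γ : ℝ} (hγ : 0 < γ)
    {ξ : (Fin d → ℤ) → Ω → ℝ} (hξ : IsWeibullPotential γ ξ P)
    {μ : Measure (Fin d → ℝ)} [IsProbabilityMeasure μ]
    (hμ : μ = (volume : Measure (Fin d → ℝ)).withDensity
      (fun x => ENNReal.ofReal (limitDensity d γ x)))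
    {B : Set (Fin d → ℝ)} (hB : MeasurableSet B) (hB0 : volume (frontier B) = 0)
    {τ₁ τ₂ : ℝ} (h₁ : 0 < τ₁) (h₂ : 0 < τ₂) :
    Tendsto (fun t => P.real {ω |
        (∀ z, rescale (scale γ t) z ∈ B → ξ z ω < threshold γ t τ₁ z) ∧
        (∀ z, rescale (scale γ t) z ∉ B → ξ z ω < threshold γ t τ₂ z)}) atTop
      (𝓝 (Real.exp (-(τ₁ * μ.real B + τ₂ * μ.real Bᶜ)))) := by
  classical
  -- Merging the two levels into one site-dependent threshold reduces the joint law to a single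
  -- no-exceedance event.
  set θ : ℝ → (Fin d → ℤ) → ℝ := fun t z =>
    if rescale (scale γ t) z ∈ B then threshold γ t τ₁ z else threshold γ t τ₂ z with hθdef
  have hpos : ∀ᶠ t in atTop, Real.exp 1 < t ∧ 0 < level d γ t τ₁ ∧ 0 < level d γ t τ₂ :=
    (eventually_gt_atTop _).and (((tendsto_level_atTop d γ h₁).eventually_gt_atTop 0).and
      ((tendsto_level_atTop d γ h₂).eventually_gt_atTop 0))
  have hnn : ∀ {t τ : ℝ}, Real.exp 1 < t → 0 < level d γ t τ → ∀ z : Fin d → ℤ,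
      0 ≤ threshold γ t τ z := fun ht hA z =>
    (Real.rpow_nonneg hA.le _).trans (level_rpow_le_threshold hγ ht z)
  have hle : ∀ {t τ : ℝ}, Real.exp 1 < t → 0 < level d γ t τ → ∀ z : Fin d → ℤ,
      Real.exp (-threshold γ t τ z ^ γ) ≤ Real.exp (-level d γ t τ) := by
    intro t τ ht hA z
    refine Real.exp_le_exp.2 (neg_le_neg ?_)
    have := Real.rpow_le_rpow (Real.rpow_nonneg hA.le _) (level_rpow_le_threshold hγ ht z) hγ.le
    rwa [← Real.rpow_mul hA.le, one_div_mul_cancel hγ.ne', Real.rpow_one] at this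
  have hset : ∀ t, {ω | (∀ z, rescale (scale γ t) z ∈ B → ξ z ω < threshold γ t τ₁ z) ∧
        (∀ z, rescale (scale γ t) z ∉ B → ξ z ω < threshold γ t τ₂ z)} =
      {ω | ∀ z, ξ z ω < θ t z} := by
    intro t
    ext ω
    simp only [Set.mem_ofPred_eq, hθdef, ← forall_and]
    refine forall_congr' fun z => ?_
    split_ifs with h <;> simp [h]
  simp_rw [hset]
  have hΛ : (ENNReal.ofReal τ₁ * μ B + ENNReal.ofReal τ₂ * μ Bᶜ).toReal =
      τ₁ * μ.real B + τ₂ * μ.real Bᶜ := by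
    rw [ENNReal.toReal_add (by finiteness) (by finiteness), ENNReal.toReal_mul,
      ENNReal.toReal_mul, ENNReal.toReal_ofReal h₁.le, ENNReal.toReal_ofReal h₂.le]
    rfl
  rw [← hΛ]
  refine hξ.tendsto_measureReal_forall_lt
    (ε := fun t => Real.exp (-level d γ t τ₁) + Real.exp (-level d γ t τ₂)) ?_ ?_ ?_
    (by finiteness) ?_
  · filter_upwards [hpos] with t ht z
    simp only [hθdef]
    split_ifs
    exacts [hnn ht.1 ht.2.1 z, hnn ht.1 ht.2.2 z]
  · have h : ∀ {τ : ℝ}, 0 < τ → Tendsto (fun t => Real.exp (-level d γ t τ)) atTop (𝓝 0) :=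
      fun hτ => Real.tendsto_exp_neg_atTop_nhds_zero.comp (tendsto_level_atTop d γ hτ)
    simpa using (h h₁).add (h h₂)
  · filter_upwards [hpos] with t ht z
    simp only [hθdef]
    have e₁ := Real.exp_pos (-level d γ t τ₁)
    have e₂ := Real.exp_pos (-level d γ t τ₂)
    split_ifs
    · linarith [hle ht.1 ht.2.1 z]
    · linarith [hle ht.1 ht.2.2 z]
  · rw [hμ]
    refine ((tendsto_tsum_tail d hγ h₁ hB hB0).add
      (tendsto_tsum_tail d hγ h₂ hB.compl (by rwa [frontier_compl]))).congr fun t => ?_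
    rw [← ENNReal.tsum_add]
    refine tsum_congr fun z => ?_
    simp only [hθdef]
    split_ifs with h <;> simp [h]

/-! ### Existence of the maximiser. -/

lemma finite_setOf_latticeNorm_le (d : ℕ) (R : ℝ) : {z : Fin d → ℤ | latticeNorm z ≤ R}.Finite := by
  refine (Set.finite_Icc (fun _ => -⌈R⌉ : Fin d → ℤ) (fun _ => ⌈R⌉)).subset fun z hz => ?_
  have h (i : Fin d) : |z i| ≤ ⌈R⌉ := by
    have h1 : |(z i : ℝ)| ≤ latticeNorm z :=
      Finset.single_le_sum (f := fun i => |(z i : ℝ)|) (fun _ _ => abs_nonneg _)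
        (Finset.mem_univ i)
    have h2 : ((|z i| : ℤ) : ℝ) ≤ (⌈R⌉ : ℤ) := by
      rw [Int.cast_abs]
      exact h1.trans (le_trans hz (Int.le_ceil R))
    exact_mod_cast h2
  exact ⟨fun i => (abs_le.1 (h i)).1, fun i => (abs_le.1 (h i)).2⟩

lemma tendsto_log_log_div_mul {γ : ℝ} :
    Tendsto (fun t => Real.log (Real.log t) / (γ * t)) atTop (𝓝 0) := by
  have h := (tendsto_log_log_div_log.mul
    Real.isLittleO_log_id_atTop.tendsto_div_nhds_zero).div_const γ
  simp only [mul_zero, zero_div] at h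
  refine h.congr' ?_
  filter_upwards [eventually_gt_atTop (Real.exp 1)] with t ht
  have h1 : 1 < Real.log t := (Real.lt_log_iff_exp_lt ((Real.exp_pos 1).trans ht)).2 ht
  have h3 : Real.log t ≠ 0 := by positivity
  simp only [id]
  field_simp

section

variable {Ω : Type*} [MeasurableSpace Ω] {P : Measure Ω} [IsProbabilityMeasure P] {d : ℕ}
  [NeZero d] {γ : ℝ} {ξ : (Fin d → ℤ) → Ω → ℝ}

/-- Almost surely the potential grows slower than any linear function. -/
lemma IsWeibullPotential.ae_finite_setOf_mul_le (hξ : IsWeibullPotential γ ξ P) (hγ : 0 < γ)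
    {μ : Measure (Fin d → ℝ)} [IsProbabilityMeasure μ]
    (hμ : μ = (volume : Measure (Fin d → ℝ)).withDensity
      (fun x => ENNReal.ofReal (limitDensity d γ x))) {δ : ℝ} (hδ : 0 < δ) :
    ∀ᵐ ω ∂P, {z | δ * latticeNorm z ≤ ξ z ω}.Finite := by
  have h := tendsto_tsum_tail d hγ one_pos (MeasurableSet.univ) (by simp)
  rw [← hμ] at h
  -- One fixed `t` suffices: its tilt has slope below `δ`, and its expected exceedance count is
  -- finite because the limiting count is. Borel–Cantelli then leaves only sites with `δ|z| ≤ ξ(z) <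
  -- a + c|z|`, hence `|z| ≤ a / (δ - c)`.
  obtain ⟨t, ht, hlev, hc, hsum⟩ := ((eventually_gt_atTop (Real.exp 1)).and
    (((tendsto_level_atTop d γ one_pos).eventually_gt_atTop 0).and
    (((tendsto_log_log_div_mul (γ := γ)).eventually_lt_const hδ).and
      (h.eventually_ne (b₂ := ∞) (by finiteness))))).exists
  simp only [Set.indicator_univ] at hsum
  have hθ (z : Fin d → ℤ) : 0 ≤ threshold γ t 1 z :=
    (Real.rpow_nonneg hlev.le _).trans (level_rpow_le_threshold hγ ht z)
  rw [tsum_congr fun z => (hξ.measure_le z (hθ z)).symm] at hsum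
  filter_upwards [ae_finite_setOfPred_mem hsum] with ω hω
  set a := level d γ t 1 ^ (1 / γ)
  set c := Real.log (Real.log t) / (γ * t) with hcdef
  refine (hω.union (finite_setOf_latticeNorm_le d (a / (δ - c)))).subset fun z hz => ?_
  by_cases hz' : threshold γ t 1 z ≤ ξ z ω
  · exact Or.inl hz'
  · right
    have e : threshold γ t 1 z = a + c * latticeNorm z := by
      unfold threshold
      rw [hcdef]
      ring
    have hz1 : δ * latticeNorm z ≤ ξ z ω := hz
    rw [e, not_le] at hz'
    change latticeNorm z ≤ _
    rw [le_div_iff₀ (by linarith)]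
    linarith

/-- Countably many slopes `1/(n+1)` give one null set for all `t`. If `1/(n+1)` is below the slope
of the tilt, then outside a finite set `Ψ_t ≤ 0 ≤ ξ(0) = Ψ_t(0)`. -/
lemma IsWeibullPotential.ae_exists_isMaximiser (hξ : IsWeibullPotential γ ξ P) (hγ : 0 < γ)
    {μ : Measure (Fin d → ℝ)} [IsProbabilityMeasure μ]
    (hμ : μ = (volume : Measure (Fin d → ℝ)).withDensity
      (fun x => ENNReal.ofReal (limitDensity d γ x))) :
    ∀ᵐ ω ∂P, ∀ t : ℝ, Real.exp 1 < t → ∃ z, IsMaximiser γ (fun y => ξ y ω) t z := by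
  have h0 : ∀ᵐ ω ∂P, 0 ≤ ξ 0 ω := by
    rw [ae_iff]
    simp only [not_le]
    rw [hξ.distrib 0 0 le_rfl, Real.zero_rpow hγ.ne']
    simp
  have hfin : ∀ᵐ ω ∂P, ∀ n : ℕ, {z | 1 / ((n : ℝ) + 1) * latticeNorm z ≤ ξ z ω}.Finite :=
    ae_all_iff.2 fun n => hξ.ae_finite_setOf_mul_le hγ hμ (by positivity)
  filter_upwards [h0, hfin] with ω hω0 hω t ht
  have ht0 : 0 < t := (Real.exp_pos 1).trans ht
  have h1 : 1 < Real.log t := (Real.lt_log_iff_exp_lt ht0).2 ht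
  have h2 : 0 < Real.log (Real.log t) := Real.log_pos h1
  have hc : 0 < Real.log (Real.log t) / (γ * t) := by positivity
  obtain ⟨n, hn⟩ := exists_nat_one_div_lt hc
  have hPsi (z : Fin d → ℤ) : Psi γ (fun y => ξ y ω) t z =
      ξ z ω - Real.log (Real.log t) / (γ * t) * latticeNorm z := by
    unfold Psi
    ring
  have hN0 : latticeNorm (0 : Fin d → ℤ) = 0 := by simp [latticeNorm]
  obtain ⟨z, -, hz⟩ := Set.exists_max_image _ (Psi γ (fun y => ξ y ω) t) (hω n)
    ⟨0, by simpa [hN0] using hω0⟩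
  refine ⟨z, fun y => ?_⟩
  by_cases hy : 1 / ((n : ℝ) + 1) * latticeNorm y ≤ ξ y ω
  · exact hz y hy
  · have hz0 := hz 0 (by simpa [hN0] using hω0)
    refine le_trans ?_ hz0
    rw [hPsi, hPsi, hN0]
    have := mul_le_mul_of_nonneg_right hn.le (latticeNorm_nonneg y)
    linarith

end

/-! ### Density of the limit law. -/

lemma expMeasure_apply (r : ℝ) {s : Set ℝ} (hs : MeasurableSet s) :
    expMeasure r s = ∫⁻ x, s.indicator 1 x * exponentialPDF r x := by
  unfold expMeasure gammaMeasure
  rw [withDensity_apply _ hs, ← lintegral_indicator hs]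
  refine lintegral_congr fun x => ?_
  by_cases h : x ∈ s <;> simp [h, exponentialPDF, gammaPDF, exponentialPDFReal]

lemma signedExpLaw_eq {r : ℝ} (hr : 0 < r) :
    signedExpLaw r =
      (volume : Measure ℝ).withDensity fun x => ENNReal.ofReal (r / 2 * Real.exp (-(r * |x|))) := by
  have := isProbabilityMeasure_expMeasure hr
  have hpdf : Measurable (exponentialPDF r) :=
    (measurable_exponentialPDFReal r).ennreal_ofReal
  refine Measure.ext fun s hs => ?_
  have hm : MeasurableSet ((fun p : ℝ × ℝ => p.1 * p.2) ⁻¹' s) :=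
    (measurable_fst.mul measurable_snd) hs
  have hneg : expMeasure r ((fun x => -x) ⁻¹' s) =
      ∫⁻ x, s.indicator 1 x * exponentialPDF r (-x) := by
    rw [expMeasure_apply r (measurable_neg hs), ← lintegral_neg_eq_self]
    refine lintegral_congr fun x => ?_
    congr 1
    have h : -x ∈ (fun x => -x) ⁻¹' s ↔ x ∈ s := by
      rw [Set.mem_preimage, neg_neg]
    by_cases hx : x ∈ s
    · rw [Set.indicator_of_mem hx, Set.indicator_of_mem (h.2 hx)]
      rfl
    · rw [Set.indicator_of_notMem hx, Set.indicator_of_notMem (mt h.1 hx)]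
  have hind : Measurable (s.indicator (1 : ℝ → ℝ≥0∞)) := measurable_one.indicator hs
  have hm1 : Measurable fun x => s.indicator 1 x * exponentialPDF r x := hind.mul hpdf
  have hm2 : Measurable fun x => s.indicator 1 x * exponentialPDF r (-x) :=
    hind.mul (hpdf.comp measurable_neg)
  unfold signedExpLaw
  rw [Measure.map_apply (by fun_prop) hs, Measure.prod_apply hm]
  unfold signLaw
  rw [lintegral_add_measure, lintegral_smul_measure, lintegral_smul_measure, lintegral_dirac,
    lintegral_dirac]
  have e1 : Prod.mk (1 : ℝ) ⁻¹' ((fun p : ℝ × ℝ => p.1 * p.2) ⁻¹' s) = s := by ext; simp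
  have e2 : Prod.mk (-1 : ℝ) ⁻¹' ((fun p : ℝ × ℝ => p.1 * p.2) ⁻¹' s) = (fun x => -x) ⁻¹' s := by
    ext; simp
  rw [e1, e2, hneg, expMeasure_apply r hs, smul_eq_mul, smul_eq_mul,
    ← lintegral_const_mul _ hm1, ← lintegral_const_mul _ hm2,
    ← lintegral_add_left (hm1.const_mul _), withDensity_apply _ hs,
    ← lintegral_indicator hs]
  refine lintegral_congr_ae ?_
  -- At `0` both reflected exponential densities are nonzero, so the formulas agree only almost
  -- everywhere.
  filter_upwards [(Set.countable_singleton (0 : ℝ)).ae_notMem volume] with x hx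
  have hx0 : x ≠ 0 := hx
  by_cases h : x ∈ s
  · simp only [h, Set.indicator_of_mem, Pi.one_apply, one_mul]
    rcases lt_or_gt_of_ne hx0 with hlt | hgt
    · rw [exponentialPDF_of_neg hlt, exponentialPDF_of_nonneg (by linarith), mul_zero, zero_add,
        ← ENNReal.ofReal_mul (by norm_num), abs_of_neg hlt]
      congr 1
      ring
    · rw [exponentialPDF_of_nonneg hgt.le, exponentialPDF_of_neg (by linarith), mul_zero, add_zero,
        ← ENNReal.ofReal_mul (by norm_num), abs_of_pos hgt]
      congr 1
      ring
  · simp [h]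

/-- A product of probability measures with densities has the product density. -/
lemma pi_withDensity_ofReal {ι : Type*} [Fintype ι] (f : ℝ → ℝ) (hf : Measurable f)
    (hf0 : ∀ x, 0 ≤ f x)
    [IsProbabilityMeasure ((volume : Measure ℝ).withDensity fun x => ENNReal.ofReal (f x))] :
    Measure.pi (fun _ : ι => (volume : Measure ℝ).withDensity fun x => ENNReal.ofReal (f x)) =
      (volume : Measure (ι → ℝ)).withDensity fun x => ENNReal.ofReal (∏ i, f (x i)) := by
  have hint : Integrable f := by
    refine ⟨hf.aestronglyMeasurable, ?_⟩
    have h := measure_univ (μ := (volume : Measure ℝ).withDensity fun x => ENNReal.ofReal (f x))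
    rw [withDensity_apply _ MeasurableSet.univ, setLIntegral_univ] at h
    rw [hasFiniteIntegral_iff_ofReal (Eventually.of_forall hf0), h]
    exact ENNReal.one_lt_top
  refine Measure.pi_eq fun s hs => ?_
  have hg (i : ι) : Integrable ((s i).indicator f) := hint.indicator (hs i)
  have hg0 (i : ι) (x : ℝ) : 0 ≤ (s i).indicator f x := Set.indicator_nonneg (fun x _ => hf0 x) x
  have h1 (i : ι) : ((volume : Measure ℝ).withDensity fun x => ENNReal.ofReal (f x)) (s i) =
      ENNReal.ofReal (∫ x, (s i).indicator f x) := by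
    rw [withDensity_apply _ (hs i), ofReal_integral_eq_lintegral_ofReal (hg i)
      (Eventually.of_forall (hg0 i)), ← lintegral_indicator (hs i)]
    refine lintegral_congr fun x => ?_
    by_cases h : x ∈ s i <;> simp [h]
  have hpi : MeasurableSet (Set.univ.pi s) := MeasurableSet.univ_pi hs
  have hprod : Integrable fun x : ι → ℝ => ∏ i, (s i).indicator f (x i) :=
    Integrable.fintype_prod hg
  -- With each factor written as a real integral, Fubini for finite products applies to the
  -- truncated densities.
  simp_rw [h1]
  rw [← ENNReal.ofReal_prod_of_nonneg (fun i _ => integral_nonneg (hg0 i)),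
    ← integral_fintype_prod_volume_eq_prod (fun i => (s i).indicator f),
    ofReal_integral_eq_lintegral_ofReal hprod
      (Eventually.of_forall fun x => Finset.prod_nonneg fun i _ => hg0 i (x i)),
    withDensity_apply _ hpi, ← lintegral_indicator hpi]
  refine lintegral_congr fun x => ?_
  by_cases h : x ∈ Set.univ.pi s
  · rw [Set.indicator_of_mem h]
    congr 1
    exact Finset.prod_congr rfl fun i _ => (Set.indicator_of_mem (h i trivial) f).symm
  · rw [Set.indicator_of_notMem h]
    obtain ⟨i, hi⟩ : ∃ i, x i ∉ s i := by simpa [Set.mem_pi] using h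
    rw [Finset.prod_eq_zero (Finset.mem_univ i) (Set.indicator_of_notMem hi f), ENNReal.ofReal_zero]

lemma limitLaw_eq_withDensity (d : ℕ) [NeZero d] (γ : ℝ) :
    limitLaw d γ = (volume : Measure (Fin d → ℝ)).withDensity
      (fun x => ENNReal.ofReal (limitDensity d γ x)) := by
  have hd : (0 : ℝ) < d := by exact_mod_cast Nat.pos_of_ne_zero (NeZero.ne d)
  set r : ℝ := (d : ℝ) ^ (1 - 1 / γ) with hr
  have hr0 : 0 < r := Real.rpow_pos_of_pos hd _
  have hprob := isProbabilityMeasure_signedExpLaw hr0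
  unfold limitLaw
  rw [signedExpLaw_eq hr0] at hprob ⊢
  rw [pi_withDensity_ofReal _ (by fun_prop) (fun x => by positivity)]
  congr 1
  funext x
  congr 1
  rw [Finset.prod_mul_distrib, ← Real.exp_sum, limitDensity_eq, ← hr, Finset.mul_sum,
    Finset.sum_neg_distrib, Finset.prod_const, Finset.card_univ, Fintype.card_fin, div_pow,
    normConst, mul_comm (d : ℝ), Real.rpow_mul hd.le, Real.rpow_natCast]

/-! ### From the joint law of the maxima to the location of the maximiser. -/

lemma threshold_antitone {d : ℕ} [NeZero d] {γ t τ τ' : ℝ} (hγ : 0 < γ) (ht : Real.exp 1 < t)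
    (hτ : 0 < τ) (hle : τ ≤ τ') (hA : 0 ≤ level d γ t τ') (z : Fin d → ℤ) :
    threshold γ t τ' z ≤ threshold γ t τ z := by
  have hr := scale_pos (γ := γ) ht
  have hD := normConst_pos d γ
  have hτ' : 0 < τ' := hτ.trans_le hle
  have h : level d γ t τ' ≤ level d γ t τ := by
    unfold level
    gcongr
  unfold threshold
  gcongr

/-- No rescaled site in `B` exceeds the level with parameter `τ₁`, and none outside `B` exceeds the
level with parameter `τ₂`. -/
def noExceedance {Ω : Type*} {d : ℕ} (γ : ℝ) (ξ : (Fin d → ℤ) → Ω → ℝ) (B : Set (Fin d → ℝ))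
    (t τ₁ τ₂ : ℝ) : Set Ω :=
  {ω | (∀ z, rescale (scale γ t) z ∈ B → ξ z ω < threshold γ t τ₁ z) ∧
    (∀ z, rescale (scale γ t) z ∉ B → ξ z ω < threshold γ t τ₂ z)}

lemma measurableSet_noExceedance {Ω : Type*} [MeasurableSpace Ω] {d : ℕ} {γ : ℝ}
    {ξ : (Fin d → ℤ) → Ω → ℝ} (hξ : ∀ z, Measurable (ξ z)) (B : Set (Fin d → ℝ)) (t τ₁ τ₂ : ℝ) :
    MeasurableSet (noExceedance γ ξ B t τ₁ τ₂) := by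
  have h (τ : ℝ) (p : (Fin d → ℤ) → Prop) :
      MeasurableSet {ω | ∀ z, p z → ξ z ω < threshold γ t τ z} := by
    simp only [Set.ofPred_forall]
    exact MeasurableSet.iInter fun z => MeasurableSet.iInter fun _ =>
      measurableSet_lt (hξ z) measurable_const
  exact (h τ₁ _).inter (h τ₂ _)

/-- The expression is the full geometric series of the discretisation with mesh `δ`; its limit is a
quotient of derivatives at `0`. -/
lemma tendsto_geometric_ratio (β : ℝ) :
    Tendsto (fun δ => Real.exp (-δ) * (Real.exp (-(β * δ)) - Real.exp (-δ)) / (1 - Real.exp (-δ)))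
      (𝓝[>] 0) (𝓝 (1 - β)) := by
  have hexp (b : ℝ) : HasDerivAt (fun δ => Real.exp (-(b * δ))) (-b) 0 := by
    simpa using ((hasDerivAt_id (0 : ℝ)).const_mul b).neg.exp
  have h1 := ((hexp β).sub (hexp 1)).tendsto_slope_zero_right
  have h2 := ((hexp 1).const_sub 1).tendsto_slope_zero_right
  have h3 : Tendsto (fun δ => Real.exp (-δ)) (𝓝[>] (0 : ℝ)) (𝓝 1) := by
    have : Continuous fun δ : ℝ => Real.exp (-δ) := by fun_prop
    simpa using (this.tendsto 0).mono_left nhdsWithin_le_nhds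
  have h4 := h3.mul (h1.div h2 (by norm_num))
  have e : (1 : ℝ) * ((-β - -1) / - -1) = 1 - β := by ring
  rw [e] at h4
  refine h4.congr' ?_
  filter_upwards [self_mem_nhdsWithin] with δ hδ
  have hδ0 : (δ : ℝ) ≠ 0 := (ne_of_gt hδ)
  have h5 : 1 - Real.exp (-δ) ≠ 0 := by
    have : Real.exp (-δ) < 1 := Real.exp_lt_one_iff.2 (by simpa using hδ)
    linarith
  simp only [Pi.sub_apply, Pi.div_apply, zero_add, mul_zero, neg_zero, Real.exp_zero, sub_self,
    sub_zero, one_mul, smul_eq_mul]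
  field_simp

/-- The sum discretises the probability that a rate-`α` clock rings before an independent rate-`β`
one. Because `α + β = 1`, its terms are geometric with ratio `exp(-δ)`. The grid starts at `δ`, as
levels require `τ > 0`, and `K` is finite so that limits in `t` may be summed. -/
lemma exists_lt_sum_exp {α β c : ℝ} (hαβ : α + β = 1) (hc : c < α) :
    ∃ δ : ℝ, 0 < δ ∧ ∃ K : ℕ, c < ∑ j ∈ Finset.range K,
      (Real.exp (-(((j : ℝ) + 1) * δ * α + ((j : ℝ) + 2) * δ * β)) -
        Real.exp (-(((j : ℝ) + 2) * δ * α + ((j : ℝ) + 2) * δ * β))) := by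
  have hα : 1 - β = α := by linarith
  have h := tendsto_geometric_ratio β
  rw [hα] at h
  obtain ⟨δ, hδ, hδ0⟩ := ((h.eventually_const_lt hc).and self_mem_nhdsWithin).exists
  have hδ0 : 0 < δ := hδ0
  refine ⟨δ, hδ0, ?_⟩
  have hq : Real.exp (-δ) < 1 := Real.exp_lt_one_iff.2 (by linarith)
  have hg := ((hasSum_geometric_of_lt_one (Real.exp_nonneg (-δ)) hq).mul_left
    (Real.exp (-δ) * (Real.exp (-(β * δ)) - Real.exp (-δ)))).tendsto_sum_nat
  rw [← div_eq_mul_inv] at hg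
  obtain ⟨K, hK⟩ := (hg.eventually_const_lt hδ).exists
  refine ⟨K, hK.trans_eq (Finset.sum_congr rfl fun j _ => ?_)⟩
  have hαδ : α = 1 - β := hα.symm
  rw [← Real.exp_nat_mul, mul_sub, sub_mul, ← Real.exp_add, ← Real.exp_add, ← Real.exp_add,
    ← Real.exp_add, hαδ]
  congr 2 <;> ring

section

variable {Ω : Type*} [MeasurableSpace Ω] {P : Measure Ω} [IsProbabilityMeasure P] {d : ℕ}
  [NeZero d] {γ : ℝ} {ξ : (Fin d → ℤ) → Ω → ℝ}

/-- Discretising the height of the maximum over `B` gives a lower bound for the probability that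
the maximiser lies in `B`. -/
lemma sum_noExceedance_le (hξ : ∀ z, Measurable (ξ z)) (hγ : 0 < γ) {t : ℝ}
    (ht : Real.exp 1 < t) (B : Set (Fin d → ℝ)) {Z : Ω → (Fin d → ℤ)}
    (hZ : ∀ᵐ ω ∂P, IsMaximiser γ (fun y => ξ y ω) t (Z ω)) {a : ℕ → ℝ} (ha : Monotone a)
    (ha0 : ∀ j, 0 < a j) {K : ℕ} (hA : ∀ j ≤ K, 0 ≤ level d γ t (a j)) :
    ∑ j ∈ Finset.range K, (P.real (noExceedance γ ξ B t (a j) (a (j + 1))) -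
        P.real (noExceedance γ ξ B t (a (j + 1)) (a (j + 1)))) ≤
      P.real {ω | rescale (scale γ t) (Z ω) ∈ B} := by
  have hanti : ∀ {i j : ℕ}, i ≤ j → j ≤ K → ∀ z : Fin d → ℤ,
      threshold γ t (a j) z ≤ threshold γ t (a i) z := fun hij hj z =>
    threshold_antitone hγ ht (ha0 _) (ha hij) (hA _ hj) z
  -- On `E j` the tilted potential over `B` reaches level `a (j+1)` but stays below level `a j`,
  -- while outside `B` it stays below level `a (j+1)`. So the bands are disjoint and the maximiser
  -- must lie in `B`.
  set E : ℕ → Set Ω := fun j => noExceedance γ ξ B t (a j) (a (j + 1)) \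
    noExceedance γ ξ B t (a (j + 1)) (a (j + 1)) with hE
  have hEm (j : ℕ) : MeasurableSet (E j) :=
    (measurableSet_noExceedance hξ B t _ _).diff (measurableSet_noExceedance hξ B t _ _)
  have hex : ∀ {j : ℕ} {ω : Ω}, ω ∈ E j →
      ∃ z, rescale (scale γ t) z ∈ B ∧ threshold γ t (a (j + 1)) z ≤ ξ z ω := by
    intro j ω hω
    by_contra! h
    exact hω.2 ⟨h, hω.1.2⟩
  have hdisj' : ∀ {i j : ℕ}, i < j → j < K → Disjoint (E i) (E j) := by
    intro i j hij hj
    rw [Set.disjoint_left]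
    intro ω hi hj'
    obtain ⟨z, hzB, hz⟩ := hex hi
    have h1 := hj'.1.1 z hzB
    have h2 := hanti (Nat.succ_le_of_lt hij) hj.le z
    exact absurd (h1.trans_le h2) (not_lt.2 hz)
  have hdisj : (Finset.range K : Set ℕ).PairwiseDisjoint E := by
    intro i hi j hj hij
    have hi := Finset.mem_range.1 hi
    have hj := Finset.mem_range.1 hj
    rcases lt_or_gt_of_ne hij with h | h
    exacts [hdisj' h hj, (hdisj' h hi).symm]
  have hreal : ∀ j ∈ Finset.range K, P.real (noExceedance γ ξ B t (a j) (a (j + 1))) -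
      P.real (noExceedance γ ξ B t (a (j + 1)) (a (j + 1))) = P.real (E j) := by
    intro j hj
    have hsub : noExceedance γ ξ B t (a (j + 1)) (a (j + 1)) ⊆
        noExceedance γ ξ B t (a j) (a (j + 1)) := fun ω hω =>
      ⟨fun z hz => (hω.1 z hz).trans_le (hanti j.le_succ (Finset.mem_range.1 hj) z), hω.2⟩
    exact (measureReal_sdiff hsub (measurableSet_noExceedance hξ B t _ _)).symm
  rw [Finset.sum_congr rfl hreal, ← measureReal_biUnion_finset hdisj fun j _ => hEm j]
  refine ENNReal.toReal_mono (measure_ne_top _ _) (measure_mono_ae ?_)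
  filter_upwards [hZ] with ω hω hmem
  obtain ⟨j, -, hj⟩ := Set.mem_iUnion₂.1 hmem
  obtain ⟨z, -, hz⟩ := hex hj
  by_contra hnot
  have h1 := hj.1.2 (Z ω) hnot
  have h2 := hω z
  unfold Psi at h2
  unfold threshold at h1 hz
  linarith

lemma eventually_lt_measureReal_rescale (hξ : IsWeibullPotential γ ξ P) (hγ : 0 < γ)
    {Z : ℝ → Ω → (Fin d → ℤ)}
    (hZ : ∀ᶠ t in atTop, ∀ᵐ ω ∂P, IsMaximiser γ (fun y => ξ y ω) t (Z t ω))
    {B : Set (Fin d → ℝ)} (hB : MeasurableSet B) (hB0 : volume (frontier B) = 0) {c : ℝ}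
    (hc : c < (limitLaw d γ).real B) :
    ∀ᶠ t in atTop, c < P.real {ω | rescale (scale γ t) (Z t ω) ∈ B} := by
  obtain ⟨δ, hδ, K, hK⟩ := exists_lt_sum_exp
    (probReal_add_probReal_compl (μ := limitLaw d γ) hB) hc
  set a : ℕ → ℝ := fun j => ((j : ℝ) + 1) * δ with ha
  have ha0 (j : ℕ) : 0 < a j := by positivity
  have hmono : Monotone a := fun i j hij => by
    simp only [ha]
    gcongr
  have ha1 (j : ℕ) : ((j : ℝ) + 2) * δ = a (j + 1) := by
    simp only [ha]
    push_cast
    ring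
  have ha2 (j : ℕ) : ((j : ℝ) + 1) * δ = a j := rfl
  simp_rw [ha1, ha2] at hK
  have hlim {τ₁ τ₂ : ℝ} (h₁ : 0 < τ₁) (h₂ : 0 < τ₂) :=
    hξ.tendsto_measureReal_forall_lt_threshold hγ (limitLaw_eq_withDensity d γ) hB hB0 h₁ h₂
  have hsum := tendsto_finsetSum (Finset.range K) fun j _ =>
    (hlim (ha0 j) (ha0 (j + 1))).sub (hlim (ha0 (j + 1)) (ha0 (j + 1)))
  have hlevel : ∀ᶠ t in atTop, ∀ j ∈ Finset.range (K + 1), 0 ≤ level d γ t (a j) :=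
    (Finset.eventually_all _).2 fun j _ =>
      (tendsto_level_atTop d γ (ha0 j)).eventually_ge_atTop 0
  filter_upwards [hsum.eventually_const_lt hK, hlevel, hZ, eventually_gt_atTop (Real.exp 1)]
    with t h1 h2 h3 ht
  exact h1.trans_le (sum_noExceedance_le hξ.measurable hγ ht B h3 hmono ha0
    fun j hj => h2 j (Finset.mem_range.2 (Nat.lt_succ_of_le hj)))

lemma tendsto_measureReal_rescale (hξ : IsWeibullPotential γ ξ P) (hγ : 0 < γ)
    {Z : ℝ → Ω → (Fin d → ℤ)} (hZm : ∀ t, AEMeasurable (Z t) P)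
    (hZ : ∀ᶠ t in atTop, ∀ᵐ ω ∂P, IsMaximiser γ (fun y => ξ y ω) t (Z t ω))
    {B : Set (Fin d → ℝ)} (hB : MeasurableSet B) (hB0 : volume (frontier B) = 0) :
    Tendsto (fun t => P.real {ω | rescale (scale γ t) (Z t ω) ∈ B}) atTop
      (𝓝 ((limitLaw d γ).real B)) := by
  refine tendsto_order.2 ⟨fun c hc => eventually_lt_measureReal_rescale hξ hγ hZ hB hB0 hc,
    fun c hc => ?_⟩
  have hcompl := probReal_add_probReal_compl (μ := limitLaw d γ) hB
  filter_upwards [eventually_lt_measureReal_rescale hξ hγ hZ hB.compl (by rwa [frontier_compl])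
    (c := 1 - c) (by linarith)] with t ht
  -- Measurability of `Z t` makes the probabilities of `B` and `Bᶜ` add to one, turning the lower
  -- bound for `Bᶜ` into an upper bound for `B`.
  have hm : NullMeasurableSet {ω | rescale (scale γ t) (Z t ω) ∈ B} P :=
    (((measurable_of_countable (rescale (scale γ t))).comp_aemeasurable (hZm t))
      |>.nullMeasurableSet_preimage hB)
  have h := measureReal_add_measureReal_compl₀ hm
  have e : {ω | rescale (scale γ t) (Z t ω) ∈ Bᶜ} = {ω | rescale (scale γ t) (Z t ω) ∈ B}ᶜ := rfl
  rw [e] at ht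
  rw [probReal_univ] at h
  linarith

lemma tendstoInDistribution_rescale (hξ : IsWeibullPotential γ ξ P) (hγ : 0 < γ)
    {Z : ℝ → Ω → (Fin d → ℤ)} (hZm : ∀ t, AEMeasurable (Z t) P)
    (hZ : ∀ᶠ t in atTop, ∀ᵐ ω ∂P, IsMaximiser γ (fun y => ξ y ω) t (Z t ω)) :
    TendstoInDistribution (fun (t : ℝ) (ω : Ω) => rescale (scale γ t) (Z t ω)) atTop
      (id : (Fin d → ℝ) → (Fin d → ℝ)) (fun _ => P) (limitLaw d γ) := by
  have hX (t : ℝ) : AEMeasurable (fun ω => rescale (scale γ t) (Z t ω)) P :=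
    (measurable_of_countable (rescale (scale γ t))).comp_aemeasurable (hZm t)
  refine ⟨hX, aemeasurable_id, ?_⟩
  -- Sets with null frontier are stable under intersection and include all balls, which are convex;
  -- convergence on such a π-system of small neighbourhoods implies weak convergence.
  refine IsPiSystem.tendsto_probabilityMeasure_of_tendsto_of_mem
    (S := {B : Set (Fin d → ℝ) | MeasurableSet B ∧ volume (frontier B) = 0}) ?_
    (fun s hs => hs.1) ?_ ?_
  · intro s hs t ht _
    refine ⟨hs.1.inter ht.1, measure_mono_null ((frontier_inter_subset s t).trans
      (Set.union_subset_union Set.inter_subset_left Set.inter_subset_right)) ?_⟩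
    exact measure_union_null hs.2 ht.2
  · intro u hu x hx
    obtain ⟨ε, hε, hsub⟩ := Metric.isOpen_iff.1 hu x hx
    exact ⟨Metric.ball x ε, ⟨measurableSet_ball, (convex_ball x ε).addHaar_frontier volume⟩,
      Metric.ball_mem_nhds x hε, hsub⟩
  · intro s hs
    rw [← NNReal.tendsto_coe]
    have h := tendsto_measureReal_rescale hξ hγ hZm hZ hs.1 hs.2
    convert h using 2 with t
    · exact map_measureReal_apply_of_aemeasurable (hX t) hs.1
    · simp [Measure.real, ENNReal.toReal]

end

end WeibullPAM

end

theorem theorem2 {Ω : Type*} [MeasurableSpace Ω] (P : Measure Ω) [IsProbabilityMeasure P]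
    (d : ℕ) [NeZero d] (γ : ℝ) (hγ : 0 < γ)
    (ξ : (Fin d → ℤ) → Ω → ℝ) (hξ : WeibullPAM.IsWeibullPotential γ ξ P) :
    -- the maximum of `Ψ_t` is attained
    (∀ᵐ ω ∂P, ∀ t : ℝ, Real.exp 1 < t → ∃ z, WeibullPAM.IsMaximiser γ (fun y => ξ y ω) t z) ∧
    -- the limit law has the given density
    WeibullPAM.limitLaw d γ =
      (volume : Measure (Fin d → ℝ)).withDensity
        (fun x => ENNReal.ofReal (WeibullPAM.limitDensity d γ x)) ∧
    -- every choice of a random maximiser `Z t`, rescaled, converges weakly to the limit law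
    ∀ Z : ℝ → Ω → (Fin d → ℤ),
      (∀ t, AEMeasurable (Z t) P) →
      (∀ᶠ t : ℝ in atTop, ∀ᵐ ω ∂P,
        (∃ z, WeibullPAM.IsMaximiser γ (fun y => ξ y ω) t z) →
          WeibullPAM.IsMaximiser γ (fun y => ξ y ω) t (Z t ω)) →
      TendstoInDistribution
        (fun (t : ℝ) (ω : Ω) (i : Fin d) => (Z t ω i : ℝ) / WeibullPAM.scale γ t)
        atTop (id : (Fin d → ℝ) → (Fin d → ℝ)) (fun _ => P) (WeibullPAM.limitLaw d γ) := by
  have hlaw := WeibullPAM.limitLaw_eq_withDensity d γ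
  have hmax := hξ.ae_exists_isMaximiser hγ hlaw
  refine ⟨hmax, hlaw, fun Z hZm hZ => ?_⟩
  refine WeibullPAM.tendstoInDistribution_rescale hξ hγ hZm ?_
  filter_upwards [hZ, eventually_gt_atTop (Real.exp 1)] with t hZt ht
  filter_upwards [hmax, hZt] with ω h1 h2 using h2 (h1 t ht)
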